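/- Let $l\geq 1$ and let $\mathcal C$ be a small additive category (a small preadditive category with finite biproducts). A right $\mathcal C$-module is an additive functor $\mathcal C^{op}\to \mathrm{Ab}$; exactness of sequences of modules is checked objectwise. A module $M$ is of type $\mathcal{FP}_0$ (finitely generated) if there is an epimorphism $\bigoplus_{j\in J}\hom_{\mathcal C}(-,c_j)\to M$ with $J$ finite and $c_j\in\mathcal C$; it is of type $\mathcal{FP}_1$ if the functor $\hom(M,-)$ on the category of right $\mathcal C$-modules preserves direct limits. The category $\mathcal C$ is right $1$-coherent if for every right module $M$ of type $\mathcal{FP}_1$, every submodule of $M$ of type $\mathcal{FP}_0$ is of type $\mathcal{FP}_1$. It is right $l$-uniformly regular coherent if every right module $M$ of type $\mathcal{FP}_1$ admits an exact sequence $0\to P_l\to\cdots\to P_0\to M\to 0$ with every $P_i$ finitely generated and projective. A pseudo $l$-kernel of a morphism $f:x\to y$ in $\mathcal C$ is a chain $x_l\xrightarrow{f_l}x_{l-1}\to\cdots\to x_1\xrightarrow{f_1}x_0=x$ such that $\hom_{\mathcal C}(-,x_l)\to\cdots\to\hom_{\mathcal C}(-,x_1)\to\hom_{\mathcal C}(-,x)\to\hom_{\mathcal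 C}(-,y)$ is exact; put $f_0=f$. Suppose that $\mathcal C$ is right $1$-coherent. Then the following are equivalent: (1) $\mathcal C$ is right $l$-uniformly regular coherent. (2) For every morphism $f:x\to y$ in $\mathcal C$ there exist a pseudo $l$-kernel $(f_l,\dots,f_1)$ of $f$ and an endomorphism $\alpha:x_{l-1}\to x_{l-1}$ such that $\alpha\circ f_l=0$ and $f_{l-1}\circ\alpha=f_{l-1}$. -/

import Mathlib

open CategoryTheory CategoryTheory.Limits

universe u

namespace UniformCoherence

/-- Right `C`-modules: additive functors `Cᵒᵖ ⥤ Ab`. -/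
abbrev RightModule (C : Type u) [SmallCategory C] [Preadditive C] :=
  Cᵒᵖ ⥤+ AddCommGrpCat.{u}

section Modules

variable {C : Type u} [SmallCategory C] [Preadditive C]

/-- Exactness of `A ⟶ B ⟶ D` at `B`; in a functor category it is checked objectwise. -/
def ExactAt {A B D : RightModule C} (f : A ⟶ B) (g : B ⟶ D) : Prop :=
  ∀ c : Cᵒᵖ, Function.Exact (f.hom.app c) (g.hom.app c)

/-- Type `FP₀`: there is an epimorphism onto `M` from a finite direct sum (coproduct) of
representable functors `Hom(-, c j)`. -/
def IsFPZero (M : RightModule C) : Prop :=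
  ∃ (n : ℕ) (c : Fin n → C)
    (p : (∐ fun j : Fin n => preadditiveYoneda.obj (c j)) ⟶ M.obj), Epi p

/-- Type `FP₁`: the functor `Hom(M, -) = Ext⁰(M, -)` on the category of right `C`-modules
preserves (filtered, equivalently directed) colimits. -/
def IsFPOne (M : RightModule C) : Prop :=
  IsFinitelyPresentable.{u} M

/-- A `1`-coherent module: it is of type `FP₁`, and each of its submodules
of type `FP₀` is of type `FP₁`. -/
def IsOneCoherent (M : RightModule C) : Prop :=
  IsFPOne M ∧ ∀ (S : RightModule C) (i : S ⟶ M), Mono i → IsFPZero S → IsFPOne S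

/-- An exact sequence `0 ⟶ P l ⟶ ⋯ ⟶ P 1 ⟶ P 0 ⟶ M ⟶ 0` with every `P i` finitely generated
and projective. It is written as an infinite sequence that vanishes in degrees above `l`. -/
def HasFiniteProjectiveResolution (l : ℕ) (M : RightModule C) : Prop :=
  ∃ (P : ℕ → RightModule C) (d : ∀ i, P (i + 1) ⟶ P i) (ε : P 0 ⟶ M),
    (∀ i, IsFPZero (P i) ∧ Projective (P i)) ∧
    (∀ i, l < i → IsZero (P i)) ∧
    (∀ i, ExactAt (d (i + 1)) (d i)) ∧
    ExactAt (d 0) ε ∧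
    ∀ c : Cᵒᵖ, Function.Surjective (ε.hom.app c)

end Modules

/-- `C` is right `1`-coherent: every right module of type `FP₁` is `1`-coherent. -/
def IsRightOneCoherent (C : Type u) [SmallCategory C] [Preadditive C] : Prop :=
  ∀ M : RightModule C, IsFPOne M → IsOneCoherent M

/-- `C` is right `l`-uniformly regular coherent: every right module of type `FP₁` admits an
`l`-dimensional resolution by finitely generated projective modules. -/
def IsRightUniformlyRegularCoherent (l : ℕ) (C : Type u) [SmallCategory C] [Preadditive C] :
    Prop :=
  ∀ M : RightModule C, IsFPOne M → HasFiniteProjectiveResolution l M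

section PseudoKernels

variable {C : Type u} [SmallCategory C] [Preadditive C]

/-- The objects `y, x, x₁, x₂, …` of a chain `⋯ ⟶ x₂ ⟶ x₁ ⟶ x ⟶ y`, where `x_{i+1} = X i`. -/
def chainObj (x y : C) (X : ℕ → C) : ℕ → C
  | 0 => y
  | 1 => x
  | i + 2 => X i

/-- A pseudo `n`-kernel `(f_n, …, f_1)` of `f : x ⟶ y`, with `f_i = hom i` and `f_0 = f`:
the sequence `Hom(-, x_n) ⟶ ⋯ ⟶ Hom(-, x_1) ⟶ Hom(-, x) ⟶ Hom(-, y)` is exact.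
The morphisms `hom i` with `n < i` are irrelevant (they can always be chosen to be zero). -/
structure PseudoKernel {x y : C} (f : x ⟶ y) (n : ℕ) where
  X : ℕ → C
  hom : ∀ i, chainObj x y X (i + 1) ⟶ chainObj x y X i
  hom_zero : hom 0 = f
  exact : ∀ i, i < n → ∀ c : C,
    Function.Exact (fun t : c ⟶ chainObj x y X (i + 2) => t ≫ hom (i + 1))
      (fun t : c ⟶ chainObj x y X (i + 1) => t ≫ hom i)

/-- The object `x_i` of a pseudo `n`-kernel, with `x_0 = x`. The morphism `f_i = hom i`
has source `x_i`, and target `x_{i-1}` (or `y` if `i = 0`). -/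
abbrev PseudoKernel.obj {x y : C} {f : x ⟶ y} {n : ℕ} (K : PseudoKernel f n) (i : ℕ) : C :=
  chainObj x y K.X (i + 1)

end PseudoKernels

end UniformCoherence

/-! Finite biproducts merge a finite family of generators into one, so a module of type FP₁ is the
cokernel of a map `repr x ⟶ repr y`, which by Yoneda is a morphism `f : x ⟶ y`. A pseudo `l`-kernel
of `f` is then the start of a resolution of that cokernel by representables, with `y` in degree 0
and `x_i` in degree `i + 1`.

(1) ⇒ (2): coherence makes kernels of maps between representables finitely generated, so
pseudo-kernels can be iterated forever (`exists_pseudoKernel`). Comparing the result with a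
projective resolution of length `l`, the round trip is homotopic to the identity. It vanishes above
degree `l`, and the homotopy yields `α` in degree `l`, at `x_{l-1}` (`exists_idempotent_of_isZero`).

(2) ⇒ (1): since `α` kills the image of `f_l`, which is the kernel of `f_{l-1}`, and `f_{l-1} ∘ α =
f_{l-1}`, the image of `f_{l-1}` is a retract of a representable (`projective_coimage_reprMap`).
Placed in degree `l`, it ends the resolution. -/

namespace UniformCoherence

open Opposite

/-! ### Modules through their elements, and the Yoneda lemma. -/

namespace RightModule

variable {C : Type u} [SmallCategory C] [Preadditive C]

/-- The elements of a right module at an object. -/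
abbrev Elt (M : RightModule C) (c : C) : Type u := M.obj.obj (op c)

/-- The right action of the morphisms of `C` on the elements of a right module. -/
def act (M : RightModule C) {c d : C} (f : d ⟶ c) : Elt M c →+ Elt M d :=
  (M.obj.map f.op).hom

/-- The component of a morphism of right modules at an object. -/
def app {M N : RightModule C} (φ : M ⟶ N) (c : C) : Elt M c →+ Elt N c :=
  (φ.hom.app (op c)).hom

@[simp] lemma act_id (M : RightModule C) {c : C} (m : Elt M c) : act M (𝟙 c) m = m := by
  simp [act]

lemma act_comp (M : RightModule C) {c d e : C} (f : d ⟶ c) (g : e ⟶ d) (m : Elt M c) :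
    act M (g ≫ f) m = act M g (act M f m) := by
  simp [act]

lemma act_add (M : RightModule C) {c d : C} (f g : d ⟶ c) (m : Elt M c) :
    act M (f + g) m = act M f m + act M g m := by
  have : M.obj.Additive := M.property
  simp [act]

lemma act_zero (M : RightModule C) {c d : C} (m : Elt M c) :
    act M (0 : d ⟶ c) m = 0 := by
  have := act_add M (0 : d ⟶ c) 0 m
  simpa using this

lemma app_act {M N : RightModule C} (φ : M ⟶ N) {c d : C} (f : d ⟶ c) (m : Elt M c) :
    app φ d (act M f m) = act N f (app φ c m) :=
  ConcreteCategory.congr_hom (φ.hom.naturality f.op) m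

@[simp] lemma app_comp {M N K : RightModule C} (φ : M ⟶ N) (ψ : N ⟶ K) (c : C) (m : Elt M c) :
    app (φ ≫ ψ) c m = app ψ c (app φ c m) := rfl

@[simp] lemma app_zero {M N : RightModule C} (c : C) (m : Elt M c) :
    app (0 : M ⟶ N) c m = 0 := rfl

lemma hom_ext {M N : RightModule C} {φ ψ : M ⟶ N} (h : ∀ c m, app φ c m = app ψ c m) :
    φ = ψ := by
  apply ObjectProperty.hom_ext
  ext c m
  exact h c.unop m

/-- A morphism of right modules from a natural family of group homomorphisms. -/
def homMk {M N : RightModule C} (φ : ∀ c, Elt M c →+ Elt N c)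
    (h : ∀ {c d : C} (f : d ⟶ c) (m : Elt M c), φ d (act M f m) = act N f (φ c m)) : M ⟶ N :=
  ObjectProperty.homMk
    { app c := AddCommGrpCat.ofHom (φ c.unop)
      naturality _ _ f := AddCommGrpCat.ext fun m => h f.unop m }

/-- The representable right module. -/
def repr (x : C) : RightModule C := ⟨preadditiveYoneda.obj x, additive_yonedaObj' x⟩

/-- The morphism from a representable right module given by an element. -/
def ofElt {M : RightModule C} {x : C} (m : Elt M x) : repr x ⟶ M :=
  homMk (fun c => AddMonoidHom.mk' (fun f : c ⟶ x => act M f m) fun f g => act_add M f g m)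
    fun f g => act_comp M g f m

lemma app_eq_act_app_id {M : RightModule C} {x : C} (φ : repr x ⟶ M) {c : C} (f : c ⟶ x) :
    app φ c f = act M f (app φ x (𝟙 x)) :=
  (congrArg (app φ c) (Category.comp_id f).symm).trans (app_act φ f (𝟙 x : x ⟶ x))

lemma repr_hom_ext {M : RightModule C} {x : C} {φ ψ : repr x ⟶ M}
    (h : app φ x (𝟙 x) = app ψ x (𝟙 x)) : φ = ψ :=
  hom_ext fun _ f => by rw [app_eq_act_app_id φ f, app_eq_act_app_id ψ f, h]

/-- The morphism of representable right modules induced by a morphism. -/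
def reprMap {x y : C} (f : x ⟶ y) : repr x ⟶ repr y := ofElt (M := repr y) f

lemma exists_reprMap_eq {x y : C} (φ : repr x ⟶ repr y) : ∃ f : x ⟶ y, reprMap f = φ :=
  ⟨app φ x (𝟙 x), repr_hom_ext (Category.id_comp (Y := y) _)⟩

end RightModule

/-! ### Submodules, quotients, kernels and images. -/

open RightModule

/-- A submodule of a right module. -/
structure Submod {C : Type u} [SmallCategory C] [Preadditive C] (M : RightModule C) where
  carrier : ∀ c : C, AddSubgroup (Elt M c)
  act_mem : ∀ {c d : C} (f : d ⟶ c) {m : Elt M c}, m ∈ carrier c → act M f m ∈ carrier d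

namespace Submod

variable {C : Type u} [SmallCategory C] [Preadditive C] {M N : RightModule C}

/-- A submodule as a right module. -/
def toModule (K : Submod M) : RightModule C where
  obj :=
    { obj c := AddCommGrpCat.of (K.carrier c.unop)
      map {c d} f := AddCommGrpCat.ofHom
        (((act M f.unop).comp (K.carrier c.unop).subtype).codRestrict (K.carrier d.unop)
          fun m => K.act_mem f.unop m.2)
      map_id _ := AddCommGrpCat.ext fun m => Subtype.ext (act_id M m.1)
      map_comp f g := AddCommGrpCat.ext fun m => Subtype.ext (act_comp M f.unop g.unop m.1) }
  property :=
    { map_add {_ _ f g} := AddCommGrpCat.ext fun m => Subtype.ext (act_add M f.unop g.unop m.1) }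

/-- The inclusion of a submodule. -/
def incl (K : Submod M) : K.toModule ⟶ M :=
  homMk (fun c => (K.carrier c).subtype) fun _ _ => rfl

lemma incl_injective (K : Submod M) (c : C) : Function.Injective (app K.incl c) :=
  Subtype.val_injective

lemma app_incl_mem (K : Submod M) {c : C} (m : Elt K.toModule c) :
    app K.incl c m ∈ K.carrier c :=
  m.2

/-- A morphism with values in a submodule. -/
def lift (K : Submod M) (φ : N ⟶ M) (h : ∀ c n, app φ c n ∈ K.carrier c) : N ⟶ K.toModule :=
  homMk (fun c => (app φ c).codRestrict (K.carrier c) (h c))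
    fun f m => Subtype.ext (app_act φ f m)

/-- The quotient by a submodule. -/
def quotient (K : Submod M) : RightModule C where
  obj :=
    { obj c := AddCommGrpCat.of (Elt M c.unop ⧸ K.carrier c.unop)
      map {c d} f := AddCommGrpCat.ofHom
        (QuotientAddGroup.map (K.carrier c.unop) (K.carrier d.unop) (act M f.unop)
          fun _ h => K.act_mem f.unop h)
      map_id c := AddCommGrpCat.ext fun m => by
        obtain ⟨m, rfl⟩ := QuotientAddGroup.mk_surjective m
        exact congrArg (QuotientAddGroup.mk (s := K.carrier c.unop)) (act_id M m)
      map_comp {c d e} f g := AddCommGrpCat.ext fun m => by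
        obtain ⟨m, rfl⟩ := QuotientAddGroup.mk_surjective m
        exact congrArg (QuotientAddGroup.mk (s := K.carrier e.unop))
          (act_comp M f.unop g.unop m) }
  property :=
    { map_add {c d f g} := AddCommGrpCat.ext fun m => by
        obtain ⟨m, rfl⟩ := QuotientAddGroup.mk_surjective m
        exact congrArg (QuotientAddGroup.mk (s := K.carrier d.unop))
          (act_add M f.unop g.unop m) }

/-- The projection to the quotient. -/
def proj (K : Submod M) : M ⟶ K.quotient :=
  homMk (fun c => QuotientAddGroup.mk' (K.carrier c)) fun _ _ => rfl

lemma proj_surjective (K : Submod M) (c : C) : Function.Surjective (app K.proj c) :=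
  QuotientAddGroup.mk_surjective

lemma app_proj_eq_zero_iff (K : Submod M) {c : C} (m : Elt M c) :
    app K.proj c m = 0 ↔ m ∈ K.carrier c :=
  QuotientAddGroup.eq_zero_iff m

/-- The morphism from a quotient induced by a morphism that kills the submodule. -/
def desc (K : Submod M) (φ : M ⟶ N) (h : ∀ c, ∀ m ∈ K.carrier c, app φ c m = 0) :
    K.quotient ⟶ N :=
  homMk (fun c => QuotientAddGroup.lift (K.carrier c) (app φ c) (h c)) fun {c d} f m => by
    obtain ⟨m, rfl⟩ := K.proj_surjective c m
    exact app_act φ f m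

@[simp] lemma proj_desc (K : Submod M) (φ : M ⟶ N)
    (h : ∀ c, ∀ m ∈ K.carrier c, app φ c m = 0) : K.proj ≫ K.desc φ h = φ := rfl

lemma quotient_hom_ext (K : Submod M) {φ ψ : K.quotient ⟶ N} (h : K.proj ≫ φ = K.proj ≫ ψ) :
    φ = ψ :=
  hom_ext fun c m => by
    obtain ⟨m, rfl⟩ := K.proj_surjective c m
    exact congrArg (fun χ => app χ c m) h

/-- The kernel of a morphism. -/
def ker (φ : M ⟶ N) : Submod M where
  carrier c := (app φ c).ker
  act_mem f m h := by
    rw [AddMonoidHom.mem_ker] at h ⊢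
    rw [app_act, h, map_zero]

lemma mem_ker (φ : M ⟶ N) {c : C} (m : Elt M c) : m ∈ (ker φ).carrier c ↔ app φ c m = 0 := Iff.rfl

/-- The image of a morphism. -/
def range (φ : M ⟶ N) : Submod N where
  carrier c := (app φ c).range
  act_mem f n h := by
    obtain ⟨m, rfl⟩ := h
    exact ⟨act M f m, app_act φ f m⟩

lemma mem_range (φ : M ⟶ N) {c : C} (n : Elt N c) :
    n ∈ (range φ).carrier c ↔ ∃ m, app φ c m = n := Iff.rfl

/-- The submodule generated by one element. -/
def span {x : C} (m : Elt M x) : Submod M := range (ofElt m)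

lemma mem_span {x c : C} (m : Elt M x) (n : Elt M c) :
    n ∈ (span m).carrier c ↔ ∃ f : c ⟶ x, act M f m = n := Iff.rfl

end Submod

lemma surjective_of_epi {C : Type u} [SmallCategory C] [Preadditive C] {M N : RightModule C}
    (φ : M ⟶ N) [Epi φ] (c : C) : Function.Surjective (app φ c) := by
  have h : (Submod.range φ).proj = 0 := by
    rw [← cancel_epi φ, comp_zero]
    exact hom_ext fun c m => ((Submod.range φ).app_proj_eq_zero_iff _).2 ⟨m, rfl⟩
  intro n
  rw [← Submod.mem_range, ← Submod.app_proj_eq_zero_iff, h, app_zero]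

lemma mono_of_injective {C : Type u} [SmallCategory C] [Preadditive C] {M N : RightModule C}
    (φ : M ⟶ N) (h : ∀ c, Function.Injective (app φ c)) : Mono φ where
  right_cancellation _ _ w := hom_ext fun c m => h c (congrArg (fun χ => app χ c m) w)

/-! ### Finite presentability, and quotients as filtered colimits. -/

variable {C : Type u} [SmallCategory C] [Preadditive C]

/-- Additivity is an equation between maps out of a colimit, so it can be tested on the legs. Hence
colimits of modules are computed objectwise. -/
instance isClosedUnderColimitsOfShape_additiveFunctor (J : Type u) [SmallCategory J] :
    (additiveFunctor Cᵒᵖ AddCommGrpCat.{u}).IsClosedUnderColimitsOfShape J where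
  colimitsOfShape_le := by
    rintro F ⟨p⟩
    have hp : ∀ j, (p.diag.obj j).Additive := p.prop_diag_obj
    refine ⟨fun {X Y f g} => ?_⟩
    refine (isColimitOfPreserves ((evaluation _ _).obj X) p.isColimit).hom_ext fun j => ?_
    have h (k : X ⟶ Y) : (p.ι.app j).app X ≫ F.map k = (p.diag.obj j).map k ≫ (p.ι.app j).app Y :=
      ((p.ι.app j).naturality k).symm
    change (p.ι.app j).app X ≫ F.map (f + g) = (p.ι.app j).app X ≫ (F.map f + F.map g)
    rw [Preadditive.comp_add, h, h, h, (p.diag.obj j).map_add, Preadditive.add_comp]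

/-- The functor corepresented by a representable right module is evaluation. -/
def coyonedaReprIso (x : C) :
    AdditiveFunctor.forget Cᵒᵖ AddCommGrpCat.{u} ⋙ (evaluation _ _).obj (op x) ⋙
      CategoryTheory.forget AddCommGrpCat.{u} ≅ coyoneda.obj (op (repr x)) :=
  NatIso.ofComponents
    (fun M : RightModule C => Equiv.toIso
      { toFun := fun m : Elt M x => (ofElt m : repr x ⟶ M)
        invFun := fun φ : repr x ⟶ M => app φ x (𝟙 x)
        left_inv := fun m => act_id M m
        right_inv := fun _ => repr_hom_ext (act_id M _) })
    fun {M N} φ => by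
      ext m
      refine hom_ext fun c f => ?_
      exact (app_act φ f m).symm

attribute [local instance] Cardinal.fact_isRegular_aleph0

/-- By Yoneda the functor in question is evaluation at `x`, which preserves objectwise colimits. -/
lemma isFPOne_repr (x : C) : IsFPOne (repr x) := by
  rw [IsFPOne, isFinitelyPresentable_iff_preservesFilteredColimitsOfSize]
  refine ⟨fun J _ _ => ?_⟩
  exact preservesColimitsOfShape_of_natIso (coyonedaReprIso x)

lemma IsFPOne.of_iso {M N : RightModule C} (h : IsFPOne M) (e : M ≅ N) : IsFPOne N :=
  have : IsFinitelyPresentable.{u} M := h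
  isCardinalPresentable_of_iso e _

namespace Submod

variable {M N : RightModule C}

/-- The quotient by the image of a morphism is its cokernel. -/
def isColimitQuotientRange (φ : N ⟶ M) :
    IsColimit (CokernelCofork.ofπ (f := φ) (range φ).proj
      (hom_ext fun _ n => ((range φ).app_proj_eq_zero_iff _).2 ⟨n, rfl⟩)) :=
  CokernelCofork.IsColimit.ofπ _ _
    (fun ψ h => (range φ).desc ψ fun c m hm => by
      obtain ⟨n, rfl⟩ := hm
      exact congrArg (fun χ => app χ c n) h)
    (fun _ _ => proj_desc _ _ _)
    (fun ψ h χ hχ => quotient_hom_ext _ (hχ.trans (proj_desc _ _ _).symm))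

lemma isFPOne_quotient_range (φ : N ⟶ M) (hN : IsFPOne N) (hM : IsFPOne M) :
    IsFPOne (range φ).quotient := by
  have : ∀ k, IsCardinalPresentable.{u} ((parallelPair φ 0).obj k) Cardinal.aleph0 := by
    rintro (_ | _)
    · exact hN
    · exact hM
  exact isCardinalPresentable_of_isColimit _ (isColimitQuotientRange φ) _
    (by rw [hasCardinalLT_aleph0_iff]; infer_instance)

/-- The submodule generated by a family of elements. -/
def closure (s : Set (Σ c, Elt M c)) : Submod M where
  carrier c := AddSubgroup.closure {m | ∃ t ∈ s, ∃ f : c ⟶ t.1, act M f t.2 = m}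
  act_mem {c d} f m h := by
    refine (AddSubgroup.closure_le ((AddSubgroup.closure _).comap (act M f))).2 ?_ h
    rintro _ ⟨t, ht, g, rfl⟩
    exact AddSubgroup.subset_closure ⟨t, ht, f ≫ g, act_comp M g f t.2⟩

lemma mem_closure {s : Set (Σ c, Elt M c)} {c : C} {m : Elt M c} (h : ⟨c, m⟩ ∈ s) :
    m ∈ (closure s).carrier c :=
  AddSubgroup.subset_closure ⟨⟨c, m⟩, h, 𝟙 c, act_id M m⟩

lemma closure_le {s : Set (Σ c, Elt M c)} {K : Submod M} (h : ∀ t ∈ s, t.2 ∈ K.carrier t.1)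
    (c : C) : (closure s).carrier c ≤ K.carrier c := by
  refine (AddSubgroup.closure_le _).2 ?_
  rintro _ ⟨t, ht, f, rfl⟩
  exact K.act_mem f (h t ht)

lemma closure_mono {s t : Set (Σ c, Elt M c)} (h : s ⊆ t) (c : C) :
    (closure s).carrier c ≤ (closure t).carrier c :=
  closure_le (fun _ ha => mem_closure (h ha)) c

/-- The morphism between quotients induced by an inclusion of submodules. -/
def quotientMap (K L : Submod M) (h : ∀ c, K.carrier c ≤ L.carrier c) :
    K.quotient ⟶ L.quotient :=
  K.desc L.proj fun c m hm => (L.app_proj_eq_zero_iff m).2 (h c hm)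

lemma proj_quotientMap (K L : Submod M) (h : ∀ c, K.carrier c ≤ L.carrier c) :
    K.proj ≫ quotientMap K L h = L.proj := proj_desc _ _ _

lemma quotientMap_refl (K : Submod M) : quotientMap K K (fun _ => le_rfl) = 𝟙 K.quotient :=
  quotient_hom_ext _ ((proj_quotientMap _ _ _).trans (Category.comp_id _).symm)

lemma quotientMap_comp (K L P : Submod M) (h : ∀ c, K.carrier c ≤ L.carrier c)
    (h' : ∀ c, L.carrier c ≤ P.carrier c) :
    quotientMap K L h ≫ quotientMap L P h' =
      quotientMap K P (fun c => (h c).trans (h' c)) := by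
  apply quotient_hom_ext
  rw [← Category.assoc, proj_quotientMap, proj_quotientMap, proj_quotientMap]

/-- The finite sets of elements of a submodule. -/
abbrev FiniteSubset (K : Submod M) : Type u := Finset (Σ c, K.carrier c)

/-- The submodule generated by a finite set of elements of a submodule. -/
def finiteSpan (K : Submod M) (s : K.FiniteSubset) : Submod M :=
  closure ((fun t : Σ c, K.carrier c => ⟨t.1, t.2.1⟩) '' (s : Set (Σ c, K.carrier c)))

lemma finiteSpan_le (K : Submod M) (s : K.FiniteSubset) (c : C) :
    (K.finiteSpan s).carrier c ≤ K.carrier c := by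
  refine closure_le ?_ c
  rintro _ ⟨t, -, rfl⟩
  exact t.2.2

lemma finiteSpan_mono (K : Submod M) {s t : K.FiniteSubset} (h : s ≤ t) (c : C) :
    (K.finiteSpan s).carrier c ≤ (K.finiteSpan t).carrier c :=
  closure_mono (Set.image_mono (Finset.coe_subset.2 h)) c

lemma mem_finiteSpan_singleton (K : Submod M) {c : C} {m : Elt M c} (h : m ∈ K.carrier c) :
    m ∈ (K.finiteSpan {⟨c, m, h⟩}).carrier c :=
  mem_closure ⟨⟨c, m, h⟩, by simp, rfl⟩

/-- The quotients by the finitely generated submodules of `K`. -/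
def finiteQuotients (K : Submod M) : K.FiniteSubset ⥤ RightModule C where
  obj s := (K.finiteSpan s).quotient
  map f := quotientMap _ _ (K.finiteSpan_mono (leOfHom f))
  map_id _ := quotientMap_refl _
  map_comp _ _ := (quotientMap_comp _ _ _ _ _).symm

/-- The cocone with point `K.quotient` over the quotients by the finitely generated submodules
of `K`. -/
def quotientCocone (K : Submod M) : Cocone K.finiteQuotients where
  pt := K.quotient
  ι :=
    { app s := quotientMap _ _ (K.finiteSpan_le s)
      naturality s t f := (quotientMap_comp (K.finiteSpan s) (K.finiteSpan t) K
        (K.finiteSpan_mono (leOfHom f)) (K.finiteSpan_le t)).trans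
        (Category.comp_id _).symm }

/-- The morphism from the quotient by a finitely generated submodule to the point of a cocone. -/
def coconeι (K : Submod M) (s : Cocone K.finiteQuotients) (t : K.FiniteSubset) :
    (K.finiteSpan t).quotient ⟶ s.pt :=
  s.ι.app t

lemma quotientMap_coconeι (K : Submod M) (s : Cocone K.finiteQuotients) {t t' : K.FiniteSubset}
    (h : t ≤ t') :
    quotientMap _ _ (K.finiteSpan_mono h) ≫ K.coconeι s t' = K.coconeι s t :=
  s.w (homOfLE h)

/-- The morphism from `M` to the point of a cocone over the quotients of `M`. -/
def fromCocone (K : Submod M) (s : Cocone K.finiteQuotients) : M ⟶ s.pt :=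
  (K.finiteSpan ∅).proj ≫ K.coconeι s ∅

lemma proj_coconeι (K : Submod M) (s : Cocone K.finiteQuotients) (t : K.FiniteSubset) :
    (K.finiteSpan t).proj ≫ K.coconeι s t = K.fromCocone s := by
  rw [fromCocone, ← K.quotientMap_coconeι s (Finset.empty_subset t), ← Category.assoc,
    proj_quotientMap]

/-- A quotient is the filtered colimit of the quotients by finitely generated submodules. -/
def isColimitQuotientCocone (K : Submod M) : IsColimit K.quotientCocone where
  desc s := show K.quotient ⟶ s.pt from K.desc (K.fromCocone s) fun c m hm => by
    rw [← K.proj_coconeι s {⟨c, m, hm⟩}, app_comp,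
      (app_proj_eq_zero_iff _ _).2 (K.mem_finiteSpan_singleton hm), map_zero]
  fac s t := quotient_hom_ext (K.finiteSpan t) <| by
    change _ = (K.finiteSpan t).proj ≫ K.coconeι s t
    rw [proj_coconeι]
    change (K.finiteSpan t).proj ≫ quotientMap _ _ (K.finiteSpan_le t) ≫ K.desc _ _ = _
    rw [← Category.assoc, proj_quotientMap, proj_desc]
  uniq s φ h := quotient_hom_ext K <| by
    change K.quotient ⟶ s.pt at φ
    have h' : quotientMap _ _ (K.finiteSpan_le ∅) ≫ φ = K.coconeι s ∅ := h ∅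
    rw [proj_desc, fromCocone, ← h', ← Category.assoc, proj_quotientMap]

end Submod

/-! ### Finite generation from finite presentability. -/

section Generators

variable [HasFiniteBiproducts C]

/-- A finite family of elements of a right module can be replaced by one element. -/
lemma exists_common_generator (M : RightModule C) {ι : Type*} [Finite ι] {x : ι → C}
    (m : ∀ i, Elt M (x i)) :
    ∃ (b : C) (n : Elt M b), (∀ i, ∃ f : x i ⟶ b, act M f n = m i) ∧
      ∀ K : Submod M, (∀ i, m i ∈ K.carrier (x i)) → n ∈ K.carrier b := by
  classical
  have := Fintype.ofFinite ι
  refine ⟨⨁ x, ∑ i, act M (biproduct.π x i) (m i), fun i => ⟨biproduct.ι x i, ?_⟩,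
    fun K h => sum_mem fun i _ => K.act_mem _ (h i)⟩
  rw [map_sum, Finset.sum_eq_single i]
  · rw [← act_comp, biproduct.ι_π_self, act_id]
  · intro j _ hj
    rw [← act_comp, biproduct.ι_π_ne _ hj.symm, act_zero]
  · simp

lemma Submod.exists_generator_finiteSpan {M : RightModule C} (K : Submod M)
    (s : K.FiniteSubset) :
    ∃ (b : C) (n : Elt M b), ∀ c k, k ∈ (K.finiteSpan s).carrier c ↔
      ∃ f : c ⟶ b, act M f n = k := by
  obtain ⟨b, n, h₁, h₂⟩ := exists_common_generator M (ι := s) (fun i => i.1.2.1)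
  have hn : n ∈ (K.finiteSpan s).carrier b :=
    h₂ _ fun i => mem_closure ⟨i.1, i.2, rfl⟩
  refine ⟨b, n, fun c k => ⟨fun hk => ?_, ?_⟩⟩
  · refine (mem_span n k).1 (closure_le ?_ c hk)
    rintro _ ⟨t, ht, rfl⟩
    exact h₁ ⟨t, ht⟩
  · rintro ⟨f, rfl⟩
    exact act_mem _ f hn

/-- `M/K` is the filtered colimit of the `M/K_t` with `K_t ⊆ K` finitely generated, so its identity
factors through some `M/K_t`. -/
lemma Submod.exists_generator_of_isFPOne_quotient {M : RightModule C} (hM : IsFPOne M)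
    (K : Submod M) (hK : IsFPOne K.quotient) :
    ∃ (b : C) (n : Elt M b), ∀ c k, k ∈ K.carrier c ↔ ∃ f : c ⟶ b, act M f n = k := by
  have : IsFinitelyPresentable.{u} M := hM
  have : IsFinitelyPresentable.{u} K.quotient := hK
  obtain ⟨t, s, hs⟩ := IsFinitelyPresentable.exists_hom_of_isColimit
    K.isColimitQuotientCocone (𝟙 K.quotient)
  change K.quotient ⟶ (K.finiteSpan t).quotient at s
  change s ≫ quotientMap _ _ (K.finiteSpan_le t) = 𝟙 K.quotient at hs
  have h : (K.proj ≫ s) ≫ quotientMap _ _ (K.finiteSpan_le t) =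
      (K.finiteSpan t).proj ≫ quotientMap _ _ (K.finiteSpan_le t) := by
    rw [Category.assoc, hs, Category.comp_id, proj_quotientMap]
  -- Two maps from `M` agree in the colimit, hence at a stage `r`. One of them kills `K`, so the
  -- projection to `M/K_r` does too, and `K = K_r`.
  obtain ⟨r, i, j, hr⟩ := IsFinitelyPresentable.exists_eq_of_isColimit
    K.isColimitQuotientCocone (i := t) (j := t) (K.proj ≫ s) (K.finiteSpan t).proj h
  replace hr : (K.proj ≫ s) ≫ quotientMap _ _ (K.finiteSpan_mono (leOfHom i)) =
    (K.finiteSpan t).proj ≫ quotientMap _ _ (K.finiteSpan_mono (leOfHom j)) := hr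
  rw [proj_quotientMap, Category.assoc] at hr
  obtain ⟨b, n, hn⟩ := K.exists_generator_finiteSpan r
  refine ⟨b, n, fun c k => ⟨fun hk => (hn c k).1 ?_, fun hk => K.finiteSpan_le r c ((hn c k).2 hk)⟩⟩
  rw [← app_proj_eq_zero_iff, ← hr, app_comp, (app_proj_eq_zero_iff _ _).2 hk, map_zero]

/-- The same colimit with `K = M`: its point is zero, so the projection `M ⟶ M/M_r` already vanishes
at a finite stage. -/
lemma IsFPOne.exists_generator {M : RightModule C} (hM : IsFPOne M) :
    ∃ (b : C) (n : Elt M b), ∀ c (k : Elt M c), ∃ f : c ⟶ b, act M f n = k := by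
  have : IsFinitelyPresentable.{u} M := hM
  let K : Submod M := Submod.range (𝟙 M)
  have hK : K.proj = 0 := hom_ext fun c m => (K.app_proj_eq_zero_iff m).2 ⟨m, rfl⟩
  have h : (K.finiteSpan ∅).proj ≫ Submod.quotientMap _ _ (K.finiteSpan_le ∅) =
      0 ≫ Submod.quotientMap _ _ (K.finiteSpan_le ∅) := by
    rw [Submod.proj_quotientMap, hK, zero_comp]
  obtain ⟨r, i, j, hr⟩ := IsFinitelyPresentable.exists_eq_of_isColimit
    K.isColimitQuotientCocone (i := ∅) (j := ∅) (K.finiteSpan ∅).proj 0 h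
  replace hr : (K.finiteSpan ∅).proj ≫ Submod.quotientMap _ _ (K.finiteSpan_mono (leOfHom i)) =
    0 ≫ Submod.quotientMap _ _ (K.finiteSpan_mono (leOfHom j)) := hr
  rw [Submod.proj_quotientMap, zero_comp] at hr
  obtain ⟨b, n, hn⟩ := K.exists_generator_finiteSpan r
  refine ⟨b, n, fun c k => (hn c k).1 ?_⟩
  rw [← Submod.app_proj_eq_zero_iff, hr, app_zero]

end Generators

lemma isFPZero_of_generator {M : RightModule C} {b : C} (n : Elt M b)
    (h : ∀ c (k : Elt M c), ∃ f : c ⟶ b, act M f n = k) : IsFPZero M := by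
  let p : preadditiveYoneda.obj b ⟶ M.obj := (ofElt n).hom
  have hp : Epi p := by
    have (c : Cᵒᵖ) : Epi (p.app c) := by
      rw [AddCommGrpCat.epi_iff_surjective]
      exact h c.unop
    exact NatTrans.epi_of_epi_app p
  refine ⟨1, fun _ => b, Sigma.desc fun _ => p, ?_⟩
  have : Epi (Sigma.ι (fun _ : Fin 1 => preadditiveYoneda.obj b) 0 ≫ Sigma.desc fun _ => p) := by
    rw [Sigma.ι_desc]
    exact hp
  exact epi_of_epi (Sigma.ι (fun _ : Fin 1 => preadditiveYoneda.obj b) 0) _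

lemma epi_of_surjective {M N : RightModule C} (φ : M ⟶ N)
    (h : ∀ c, Function.Surjective (app φ c)) : Epi φ where
  left_cancellation _ _ w := hom_ext fun c n => by
    obtain ⟨m, rfl⟩ := h c n
    exact congrArg (fun χ => app χ c m) w

instance projective_repr (x : C) : Projective (repr x) where
  factors {E X} φ e _ := by
    obtain ⟨m, hm⟩ := surjective_of_epi e x (app φ x (𝟙 x))
    exact ⟨ofElt m, repr_hom_ext ((congrArg (app e x) (act_id E m)).trans hm)⟩

lemma reprMap_comp {x y z : C} (f : x ⟶ y) (g : y ⟶ z) :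
    reprMap f ≫ reprMap g = reprMap (f ≫ g) :=
  hom_ext fun _ t => Category.assoc (W := _) t f g

lemma reprMap_injective {x y : C} {f g : x ⟶ y} (h : reprMap f = reprMap g) : f = g := by
  have : 𝟙 x ≫ f = 𝟙 x ≫ g := congrArg (fun χ => app χ x (𝟙 x)) h
  simpa using this

/-! ### Lifting, comparison maps and homotopies. -/

namespace ExactAt

variable {M N K P : RightModule C}

lemma comp_eq_zero {f : M ⟶ N} {g : N ⟶ K} (h : ExactAt f g) : f ≫ g = 0 :=
  hom_ext fun c m => (h (op c)).apply_apply_eq_zero m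

lemma exists_lift [Projective P] {f : M ⟶ N} {g : N ⟶ K} (h : ExactAt f g) (φ : P ⟶ N)
    (hφ : φ ≫ g = 0) : ∃ ψ : P ⟶ M, ψ ≫ f = φ := by
  let L := Submod.ker g
  let f' : M ⟶ L.toModule := L.lift f fun c m => (h (op c)).apply_apply_eq_zero m
  have : Epi f' := epi_of_surjective _ fun c n => by
    obtain ⟨m, hm⟩ := (h (op c) (app L.incl c n)).1 (L.app_incl_mem n)
    exact ⟨m, L.incl_injective c hm⟩
  let φ' : P ⟶ L.toModule := L.lift φ fun c m => congrArg (fun χ => app χ c m) hφ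
  refine ⟨Projective.factorThru φ' f', ?_⟩
  have := Projective.factorThru_comp φ' f'
  exact congrArg (fun χ => χ ≫ L.incl) this

end ExactAt

/-- Dependent choice in which extending the sequence needs the relation just established, so the
recursion carries consecutive pairs. -/
lemma exists_seq {T : ℕ → Type*} (R : ∀ i, T i → T (i + 1) → Prop) {t₀ : T 0} {t₁ : T 1}
    (h₀ : R 0 t₀ t₁) (h : ∀ i s t, R i s t → ∃ u, R (i + 1) t u) :
    ∃ t : ∀ i, T i, t 0 = t₀ ∧ ∀ i, R i (t i) (t (i + 1)) := by
  choose u hu using h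
  let F (i : ℕ) : {p : T i × T (i + 1) // R i p.1 p.2} :=
    Nat.rec ⟨(t₀, t₁), h₀⟩ (fun i p => ⟨(p.1.2, u i _ _ p.2), hu i _ _ p.2⟩) i
  exact ⟨fun i => (F i).1.1, rfl, fun i => (F i).2⟩

section Comparison

variable {A B : ℕ → RightModule C} (a : ∀ i, A (i + 1) ⟶ A i) (b : ∀ i, B (i + 1) ⟶ B i)

lemma exists_chainMap (hA : ∀ i, Projective (A (i + 1))) (ha : ∀ i, a (i + 1) ≫ a i = 0)
    (hb₀ : Epi (b 0)) (hb : ∀ i, ExactAt (b (i + 1)) (b i)) (φ₀ : A 0 ⟶ B 0) :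
    ∃ φ : ∀ i, A i ⟶ B i, φ 0 = φ₀ ∧ ∀ i, φ (i + 1) ≫ b i = a i ≫ φ i := by
  refine exists_seq (T := fun i => A i ⟶ B i) (fun i s t => t ≫ b i = a i ≫ s)
    (Projective.factorThru_comp (a 0 ≫ φ₀) (b 0)) fun i s t h => ?_
  refine (hb i).exists_lift _ ?_
  rw [Category.assoc, h, ← Category.assoc, ha, zero_comp]

lemma exists_homotopy (hA : ∀ i, Projective (A (i + 1))) (ha : ∀ i, a (i + 1) ≫ a i = 0)
    (hb : ∀ i, ExactAt (b (i + 1)) (b i)) (θ : ∀ i, A i ⟶ B i) (hθ₀ : θ 0 = 0)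
    (hθ : ∀ i, θ (i + 1) ≫ b i = a i ≫ θ i) :
    ∃ s : ∀ i, A i ⟶ B (i + 1), ∀ i, θ (i + 1) = a i ≫ s i + s (i + 1) ≫ b (i + 1) := by
  obtain ⟨t₁, ht₁⟩ := (hb 0).exists_lift (θ 1) (by rw [hθ, hθ₀, comp_zero])
  -- The homotopy may start with 0 because `θ 0 = 0`.
  obtain ⟨s, -, hs⟩ := exists_seq (T := fun i => A i ⟶ B (i + 1))
    (fun i s t => θ (i + 1) = a i ≫ s + t ≫ b (i + 1)) (t₀ := 0) (t₁ := t₁)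
    (by rw [ht₁, comp_zero]; exact (zero_add _).symm) fun i s t h => by
      obtain ⟨u, hu⟩ := (hb (i + 1)).exists_lift (θ (i + 2) - a (i + 1) ≫ t) (by
        rw [Preadditive.sub_comp, hθ, h, Preadditive.comp_add, Category.assoc,
          add_sub_cancel_right, ← Category.assoc, ha, zero_comp])
      exact ⟨u, by rw [hu, add_sub_cancel]⟩
  exact ⟨s, hs⟩

/-- If `B` vanishes in degree `n + 2`, then the image of `a n` is a direct summand of
`A (n + 1)`. -/
lemma exists_idempotent_of_isZero (hA : ∀ i, Projective (A (i + 1)))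
    (hB : ∀ i, Projective (B (i + 1))) (ha₀ : Epi (a 0)) (ha : ∀ i, ExactAt (a (i + 1)) (a i))
    (hb₀ : Epi (b 0)) (hb : ∀ i, ExactAt (b (i + 1)) (b i)) (e : A 0 ≅ B 0) {n : ℕ}
    (hn : IsZero (B (n + 2))) :
    ∃ α : A (n + 1) ⟶ A (n + 1), a (n + 1) ≫ α = 0 ∧ α ≫ a n = a n := by
  obtain ⟨φ, hφ₀, hφ⟩ := exists_chainMap a b hA (fun i => (ha i).comp_eq_zero) hb₀ hb e.hom
  obtain ⟨ψ, hψ₀, hψ⟩ := exists_chainMap b a hB (fun i => (hb i).comp_eq_zero) ha₀ ha e.inv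
  obtain ⟨s, hs⟩ := exists_homotopy a a hA (fun i => (ha i).comp_eq_zero) ha (fun i => 𝟙 (A i) - φ i ≫ ψ i)
    (by simp [hφ₀, hψ₀]) (fun i => by
      rw [Preadditive.sub_comp, Preadditive.comp_sub, Category.assoc, hψ, ← Category.assoc, hφ,
        Category.assoc, Category.id_comp, Category.comp_id])
  have hα : 𝟙 (A (n + 1)) - s (n + 1) ≫ a (n + 1) = φ (n + 1) ≫ ψ (n + 1) + a n ≫ s n := by
    rw [sub_eq_iff_eq_add, add_assoc, ← hs n, add_sub_cancel]
  -- The second form of `α`, in `hα`, gives the first equation: after `a (n + 1)`, the comparison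
  -- map passes through `B (n + 2) = 0`. The form written here gives the second.
  refine ⟨𝟙 (A (n + 1)) - s (n + 1) ≫ a (n + 1), ?_, ?_⟩
  · rw [hα, Preadditive.comp_add, ← Category.assoc, ← Category.assoc, (ha n).comp_eq_zero,
      zero_comp, add_zero, ← hφ, hn.eq_of_tgt (φ (n + 1 + 1)) 0, zero_comp, zero_comp]
  · rw [Preadditive.sub_comp, Category.assoc, (ha n).comp_eq_zero, comp_zero, sub_zero,
      Category.id_comp]

end Comparison

/-- The objects of an augmented complex. -/
def augmentedObj (M : RightModule C) (P : ℕ → RightModule C) : ℕ → RightModule C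
  | 0 => M
  | i + 1 => P i

/-- The differentials of an augmented complex. -/
def augmentedMap {M : RightModule C} {P : ℕ → RightModule C} (ε : P 0 ⟶ M)
    (d : ∀ i, P (i + 1) ⟶ P i) : ∀ i, augmentedObj M P (i + 1) ⟶ augmentedObj M P i
  | 0 => ε
  | i + 1 => d i

lemma exactAt_augmentedMap {M : RightModule C} {P : ℕ → RightModule C} {ε : P 0 ⟶ M}
    {d : ∀ i, P (i + 1) ⟶ P i} (h₀ : ExactAt (d 0) ε) (h : ∀ i, ExactAt (d (i + 1)) (d i)) :
    ∀ i, ExactAt (augmentedMap ε d (i + 1)) (augmentedMap ε d i)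
  | 0 => h₀
  | i + 1 => h i

lemma exactAt_reprMap {x y z : C} {g : z ⟶ x} {f : x ⟶ y}
    (h : ∀ c : C, Function.Exact (fun t : c ⟶ z => t ≫ g) (fun t : c ⟶ x => t ≫ f)) :
    ExactAt (reprMap g) (reprMap f) :=
  fun c => h c.unop

lemma exactAt_range_proj {M N : RightModule C} (φ : M ⟶ N) :
    ExactAt φ (Submod.range φ).proj :=
  fun c n => (Submod.range φ).app_proj_eq_zero_iff (c := c.unop) n

/-- The morphism from the coimage of a morphism to its target. -/
def Submod.fromCoimage {M N : RightModule C} (φ : M ⟶ N) : (ker φ).quotient ⟶ N :=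
  (ker φ).desc φ fun _ _ h => h

lemma Submod.fromCoimage_injective {M N : RightModule C} (φ : M ⟶ N) (c : C) :
    Function.Injective (app (fromCoimage φ) c) := by
  refine (injective_iff_map_eq_zero _).2 fun q hq => ?_
  obtain ⟨m, rfl⟩ := (ker φ).proj_surjective c q
  exact ((ker φ).app_proj_eq_zero_iff m).2 hq

lemma isFPZero_quotient_repr {x : C} (K : Submod (repr x)) : IsFPZero K.quotient :=
  isFPZero_of_generator (app K.proj x (𝟙 x)) fun c q => by
    obtain ⟨m, rfl⟩ := K.proj_surjective c q
    exact ⟨m, (app_eq_act_app_id K.proj m).symm⟩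

lemma isFPZero_repr (x : C) : IsFPZero (repr x) :=
  isFPZero_of_generator (M := repr x) (𝟙 x) fun _ f => ⟨f, Category.comp_id f⟩

/-! ### From finite resolutions to pseudo-kernels. -/

section Coherent

variable [HasFiniteBiproducts C]

/-- The coimage of `reprMap f` is a finitely generated submodule of `repr y`, hence of type FP₁ by
coherence, so the kernel has a generator. -/
lemma exists_pseudoKernel_hom (hC : IsRightOneCoherent C) {x y : C} (f : x ⟶ y) :
    ∃ (z : C) (g : z ⟶ x), ∀ c : C,
      Function.Exact (fun t : c ⟶ z => t ≫ g) (fun t : c ⟶ x => t ≫ f) := by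
  obtain ⟨z, g, hg⟩ := (Submod.ker (reprMap f)).exists_generator_of_isFPOne_quotient
    (isFPOne_repr x) ((hC _ (isFPOne_repr y)).2 _ _
      (mono_of_injective _ (Submod.fromCoimage_injective (reprMap f)))
      (isFPZero_quotient_repr _))
  exact ⟨z, g, fun c t => hg c t⟩

/-- Exactness is kept in every degree, beyond what `PseudoKernel` records, since the comparison uses
a full resolution. -/
lemma exists_pseudoKernel (hC : IsRightOneCoherent C) {x y : C} (f : x ⟶ y) (n : ℕ) :
    ∃ K : PseudoKernel f n, ∀ i, ∀ c : C,
      Function.Exact (fun t : c ⟶ chainObj x y K.X (i + 2) => t ≫ K.hom (i + 1))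
        (fun t : c ⟶ chainObj x y K.X (i + 1) => t ≫ K.hom i) := by
  choose kerObj kerMap exact_kerMap using fun (p : Σ (x y : C), x ⟶ y) =>
    exists_pseudoKernel_hom hC p.2.2
  let S (i : ℕ) : Σ (x y : C), x ⟶ y := Nat.rec ⟨x, y, f⟩ (fun _ p => ⟨kerObj p, p.1, kerMap p⟩) i
  let X (i : ℕ) : C := (S (i + 1)).1
  let hom : ∀ i, chainObj x y X (i + 1) ⟶ chainObj x y X i
    | 0 => f
    | 1 => (S 1).2.2
    | i + 2 => (S (i + 2)).2.2
  have exact : ∀ i, ∀ c : C,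
      Function.Exact (fun t : c ⟶ chainObj x y X (i + 2) => t ≫ hom (i + 1))
        (fun t : c ⟶ chainObj x y X (i + 1) => t ≫ hom i)
    | 0 => exact_kerMap (S 0)
    | 1 => exact_kerMap (S 1)
    | i + 2 => exact_kerMap (S (i + 2))
  exact ⟨⟨X, hom, rfl, fun i _ => exact i⟩, exact⟩

theorem IsRightUniformlyRegularCoherent.exists_pseudoKernel {n : ℕ}
    (h : IsRightUniformlyRegularCoherent (n + 1) C) (hC : IsRightOneCoherent C) {x y : C}
    (f : x ⟶ y) :
    ∃ (K : PseudoKernel f (n + 1)) (α : K.obj n ⟶ K.obj n),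
      K.hom (n + 1) ≫ α = 0 ∧ α ≫ K.hom n = K.hom n := by
  obtain ⟨K, hK⟩ := UniformCoherence.exists_pseudoKernel hC f (n + 1)
  let ε := (Submod.range (reprMap (K.hom 0))).proj
  have hM : IsFPOne (Submod.range (reprMap (K.hom 0))).quotient :=
    Submod.isFPOne_quotient_range _ (isFPOne_repr _) (isFPOne_repr _)
  obtain ⟨P, d, ε', hP, hP₀, hd, hd₀, hε'⟩ := h _ hM
  -- The cokernel has index 0 and `y` index 1, so `K.obj n` has index `n + 2`. The vanishing term
  -- has index `n + 3`, which is `P (n + 2)`.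
  obtain ⟨α, hα₁, hα₂⟩ := exists_idempotent_of_isZero
    (augmentedMap (P := fun i => repr (chainObj x y K.X i)) ε fun i => reprMap (K.hom i))
    (augmentedMap ε' d)
    (fun i => projective_repr _) (fun i => (hP i).2)
    (epi_of_surjective _ (Submod.proj_surjective _))
    (exactAt_augmentedMap (exactAt_range_proj _) fun i => exactAt_reprMap (hK i))
    (epi_of_surjective _ fun c => hε' (op c)) (exactAt_augmentedMap hd₀ hd) (Iso.refl _)
    (n := n + 1) (hP₀ (n + 2) (Nat.lt_succ_self _))
  obtain ⟨α, rfl⟩ := exists_reprMap_eq α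
  refine ⟨K, α, reprMap_injective ?_, reprMap_injective ?_⟩
  · rw [← reprMap_comp]
    refine hα₁.trans (hom_ext fun _ _ => comp_zero.symm)
  · rw [← reprMap_comp]
    exact hα₂

end Coherent

/-- A bijective morphism of right modules is an isomorphism. -/
noncomputable def isoOfBijective {M N : RightModule C} (φ : M ⟶ N)
    (h : ∀ c, Function.Bijective (app φ c)) : M ≅ N where
  hom := φ
  inv := homMk (fun c => ((AddEquiv.ofBijective (app φ c) (h c)).symm : Elt N c →+ Elt M c))
    fun {c d} f n => (h d).1 <| by
      refine (AddEquiv.apply_symm_apply (AddEquiv.ofBijective (app φ d) (h d)) _).trans ?_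
      rw [app_act]
      exact congrArg (act N f)
        (AddEquiv.apply_symm_apply (AddEquiv.ofBijective (app φ c) (h c)) n).symm
  hom_inv_id := hom_ext fun c =>
    AddEquiv.symm_apply_apply (AddEquiv.ofBijective (app φ c) (h c))
  inv_hom_id := hom_ext fun c =>
    AddEquiv.apply_symm_apply (AddEquiv.ofBijective (app φ c) (h c))

/-! ### From pseudo-kernels to finite resolutions. -/

section Resolutions

variable {M N P : RightModule C}

/-- Splicing at `ε ≫ i`: injectivity of `i` preserves the kernel of `ε`, and surjectivity of `ε`
preserves the image of `i`. -/
lemma HasFiniteProjectiveResolution.succ {i : N ⟶ P} {e : P ⟶ M} {n : ℕ}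
    (h : HasFiniteProjectiveResolution n N) (hP : IsFPZero P ∧ Projective P)
    (hi : ∀ c, Function.Injective (app i c)) (he : ∀ c, Function.Surjective (app e c))
    (hie : ExactAt i e) : HasFiniteProjectiveResolution (n + 1) M := by
  obtain ⟨Q, d, ε, hQ, hQ₀, hd, hd₀, hε⟩ := h
  refine ⟨augmentedObj P Q, augmentedMap (ε ≫ i) d, e, ?_, ?_, ?_, ?_, fun c => he c.unop⟩
  · rintro (_ | j)
    exacts [hP, hQ j]
  · rintro (_ | j) hj
    exacts [absurd hj (Nat.not_lt_zero _), hQ₀ j (Nat.lt_of_succ_lt_succ hj)]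
  · refine exactAt_augmentedMap (fun c m => ?_) hd
    refine Iff.trans ?_ (hd₀ c m)
    exact map_eq_zero_iff (app i c.unop) (hi c.unop)
  · intro c p
    refine (hie c p).trans ⟨?_, ?_⟩
    · rintro ⟨m, rfl⟩
      obtain ⟨q, rfl⟩ := hε c m
      exact ⟨q, rfl⟩
    · rintro ⟨q, rfl⟩
      exact ⟨ε.hom.app c q, rfl⟩

variable [HasFiniteBiproducts C]

variable (C) in
-- Provides the finitely generated projective zero module that pads resolutions above their length.
lemma exists_isZero_repr : ∃ x : C, IsZero (repr x) := by
  have := hasZeroObject_of_hasFiniteBiproducts C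
  obtain ⟨x, hx⟩ := HasZeroObject.zero (C := C)
  exact ⟨x, (IsZero.iff_id_eq_zero _).2 (repr_hom_ext (hx.eq_of_tgt (𝟙 x) 0))⟩

lemma hasFiniteProjectiveResolution_zero (hM : IsFPZero M ∧ Projective M) :
    HasFiniteProjectiveResolution 0 M := by
  obtain ⟨x, hx⟩ := exists_isZero_repr C
  have hx' {c : Cᵒᵖ} (t : (repr x).obj.obj c) : t = 0 :=
    congrArg (fun χ => app χ c.unop t) (hx.eq_of_src (𝟙 (repr x)) 0)
  refine ⟨augmentedObj M fun _ => repr x, augmentedMap (0 : repr x ⟶ M) fun _ => 0, 𝟙 M,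
    ?_, ?_, exactAt_augmentedMap ?_ ?_, ?_, fun c m => ⟨m, rfl⟩⟩
  · rintro (_ | j)
    exacts [hM, ⟨isFPZero_repr x, projective_repr x⟩]
  · rintro (_ | j) hj
    exacts [absurd hj (Nat.lt_irrefl _), hx]
  · exact fun c t => ⟨fun _ => ⟨t, (hx' t).symm⟩, fun _ => rfl⟩
  · exact fun _ c t => ⟨fun _ => ⟨t, (hx' t).symm⟩, fun _ => rfl⟩
  · exact fun c m => ⟨fun h => ⟨0, h.symm⟩, by rintro ⟨t, rfl⟩; rfl⟩

omit [HasFiniteBiproducts C] in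
-- `α` descends to a section of the projection from `repr x`: as `(α - 1) ≫ f = 0`, it is the
-- identity modulo the kernel of `f`.
lemma projective_coimage_reprMap {x y : C} (f : x ⟶ y) (α : x ⟶ x)
    (hα : ∀ c t, app (reprMap f) c t = 0 → app (reprMap α) c t = 0) (hf : α ≫ f = f) :
    Projective (Submod.ker (reprMap f)).quotient :=
  Retract.projective (Y := repr x)
    { i := (Submod.ker (reprMap f)).desc (reprMap α) fun c t ht => hα c t ht
      r := (Submod.ker (reprMap f)).proj
      retract := Submod.quotient_hom_ext _ <| by
        rw [← Category.assoc, Submod.proj_desc, Category.comp_id, ← sub_eq_zero,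
          ← Category.id_comp (Submod.proj _), ← Category.assoc, ← Preadditive.sub_comp]
        refine repr_hom_ext ?_
        refine ((Submod.ker (reprMap f)).app_proj_eq_zero_iff _).2 ?_
        change (𝟙 x ≫ α - 𝟙 x) ≫ f = 0
        rw [Preadditive.sub_comp, Category.id_comp, Category.id_comp, hf, sub_self] }

end Resolutions

variable [HasFiniteBiproducts C]

theorem isRightUniformlyRegularCoherent_of_exists_pseudoKernel {n : ℕ}
    (h : ∀ (x y : C) (f : x ⟶ y), ∃ (K : PseudoKernel f (n + 1)) (α : K.obj n ⟶ K.obj n),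
      K.hom (n + 1) ≫ α = 0 ∧ α ≫ K.hom n = K.hom n) :
    IsRightUniformlyRegularCoherent (n + 1) C := by
  intro M hM
  obtain ⟨y, m, hm⟩ := hM.exists_generator
  have hm' : ∀ c, Function.Surjective (app (ofElt m) c) := hm
  have hq : IsFPOne (Submod.ker (ofElt m)).quotient :=
    hM.of_iso (isoOfBijective (Submod.fromCoimage (ofElt m)) fun c =>
      ⟨Submod.fromCoimage_injective _ c, fun k => by
        obtain ⟨f, rfl⟩ := hm' c k
        exact ⟨app (Submod.proj _) c f, rfl⟩⟩).symm
  -- A generator of the relations is an element of `repr y` at `x`, that is, a morphism `x ⟶ y`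
  -- presenting `M`.
  obtain ⟨x, f, hf⟩ := Submod.exists_generator_of_isFPOne_quotient (isFPOne_repr y) _ hq
  change x ⟶ y at f
  obtain ⟨K, α, hα, hα'⟩ := h x y f
  have hexact {j : ℕ} (hj : j ≤ n) := exactAt_reprMap (K.exact j (Nat.lt_succ_of_le hj))
  -- Descending induction on `j`: the image of `K.hom n` is projective, and each earlier image costs
  -- one more degree.
  have key (k : ℕ) : ∀ j, j + k = n →
      HasFiniteProjectiveResolution k (Submod.ker (reprMap (K.hom j))).quotient := by
    induction k with
    | zero =>
      intro j hj
      obtain rfl : j = n := hj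
      have h₀ {c : C} (s : c ⟶ K.obj (j + 1)) : (s ≫ K.hom (j + 1)) ≫ α = 0 := by
        rw [Category.assoc, hα, comp_zero]
      refine hasFiniteProjectiveResolution_zero ⟨isFPZero_quotient_repr _,
        projective_coimage_reprMap _ α (fun c t ht => ?_) hα'⟩
      obtain ⟨s, rfl⟩ := (hexact le_rfl (op c) t).1 ht
      exact h₀ s
    | succ k ih =>
      intro j hj
      refine (ih (j + 1) (by omega)).succ (i := Submod.fromCoimage _) (e := Submod.proj _)
        ⟨isFPZero_repr _, projective_repr _⟩ (Submod.fromCoimage_injective _)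
        (Submod.proj_surjective _) fun c t => ?_
      refine (Submod.app_proj_eq_zero_iff (c := c.unop) _ t).trans
        ((hexact (by omega : j ≤ n) c t).trans ⟨?_, ?_⟩)
      · rintro ⟨s, rfl⟩
        exact ⟨app (Submod.proj _) c.unop s, rfl⟩
      · rintro ⟨q, rfl⟩
        obtain ⟨s, rfl⟩ := Submod.proj_surjective _ c.unop q
        exact ⟨s, rfl⟩
  refine (key n 0 (Nat.zero_add n)).succ (i := Submod.fromCoimage _) (e := ofElt m)
    ⟨isFPZero_repr _, projective_repr _⟩ (Submod.fromCoimage_injective _) hm' fun c t => ?_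
  refine (hf c.unop t).trans ⟨?_, ?_⟩
  · rintro ⟨s, rfl⟩
    refine ⟨app (Submod.proj _) c.unop s, ?_⟩
    change s ≫ K.hom 0 = s ≫ f
    rw [K.hom_zero]
    rfl
  · rintro ⟨q, rfl⟩
    obtain ⟨s, rfl⟩ := Submod.proj_surjective _ c.unop q
    refine ⟨s, ?_⟩
    change s ≫ f = s ≫ K.hom 0
    rw [K.hom_zero]
    rfl

end UniformCoherence

theorem mainTheorem9 (l : ℕ) (hl : 1 ≤ l) (C : Type u) [SmallCategory C] [Preadditive C]
    [HasFiniteBiproducts C] (hC : UniformCoherence.IsRightOneCoherent C) :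
    UniformCoherence.IsRightUniformlyRegularCoherent l C ↔
      ∀ (x y : C) (f : x ⟶ y),
        ∃ (K : UniformCoherence.PseudoKernel f l) (α : K.obj (l - 1) ⟶ K.obj (l - 1)),
          K.hom (l - 1 + 1) ≫ α = 0 ∧ α ≫ K.hom (l - 1) = K.hom (l - 1) := by
  -- With `l = n + 1`, the truncated `l - 1` reduces to `n` by computation.
  obtain ⟨n, rfl⟩ : ∃ n, l = n + 1 := ⟨l - 1, by omega⟩
  exact ⟨fun h x y f => h.exists_pseudoKernel hC f,
    UniformCoherence.isRightUniformlyRegularCoherent_of_exists_pseudoKernel⟩
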